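/- \textbf{Theorem (zero extension).} Let $n\ge 2$, $1<p<\infty$ and $0<s<\min\{1,n/p\}$. Let $G$ be a John domain in $\mathbb{R}^n$ such that $\dim_{\mathcal{A}}(\partial G)<n-sp$. Then there is a constant $C$, depending on $n$, $s$, $p$ and $G$ (and on whether functions are real- or complex-valued), such that for every $f\in W^{s,p}(G)$ the zero extension $E_0f$, defined by $E_0f=f$ on $G$ and $E_0f=0$ on $\mathbb{R}^n\setminus G$, belongs to $W^{s,p}(\mathbb{R}^n)$ and \[ \lVert E_0 f\rVert_{W^{s,p}(\mathbb{R}^n)}\le C\,\lVert f\rVert_{W^{s,p}(G)} . \] Here the following definitions are used. \begin{itemize} \item A bounded domain (nonempty, open and connected set) $G\subset\mathbb{R}^n$ is a \emph{John domain} if there are a point $x_0\in G$ and a constant $\beta\ge 1$ such that every $x\in G$ can be joined to $x_0$ by a rectifiable curve $\gamma:[0,\ell]\to G$, parametrized by arc length, with $\gamma(0)=x$, $\gamma(\ell)=x_0$, $\ell\le\beta\operatorname{diam}(G)$, and $\operatorname{dist}(\gamma(t),\partial G)\ge t/\beta$ for all $t\in[0,\ell]$. \item For a closed set $E\subset\mathbb{R}^n$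 with empty interior, the \emph{Aikawa dimension} $\dim_{\mathcal{A}}(E)$ is the infimum of all $0<t\le n$ for which there is a constant $C>0$ with $\int_{B(x,r)}\operatorname{dist}(y,E)^{t-n}\,dy\le C r^t$ for every $x\in E$ and all $0<r<\infty$. \item For an open set $G\subset\mathbb{R}^n$, $W^{s,p}(G)$ is the space of (real- or complex-valued) $f\in L^p(G)$ with \[ \lVert f\rVert_{W^{s,p}(G)}:=\lVert f\rVert_{L^p(G)}+\bigg(\int_G\int_G\frac{\lvert f(x)-f(y)\rvert^p}{\lvert x-y\rvert^{n+sp}}\,dy\,dx\bigg)^{1/p}<\infty . \] \end{itemize} -/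

import Mathlib

open MeasureTheory Set
open scoped ENNReal NNReal

noncomputable section

namespace FracSob

/-- A bounded domain `G ⊆ ℝⁿ` is a John domain if there are a point `x₀ ∈ G` (John center) and
`β ≥ 1` such that each `x ∈ G` is joined to `x₀` by a rectifiable curve `γ : [0, ℓ] → G`,
parametrized by arc length, with `γ 0 = x`, `γ ℓ = x₀`, `ℓ ≤ β diam G` and
`dist (γ t, ∂G) ≥ t / β` for all `t ∈ [0, ℓ]`. -/
def IsJohnDomain {n : ℕ} (G : Set (EuclideanSpace ℝ (Fin n))) : Prop :=
  IsOpen G ∧ IsConnected G ∧ Bornology.IsBounded G ∧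
    ∃ x₀ ∈ G, ∃ β : ℝ, 1 ≤ β ∧ ∀ x ∈ G,
      ∃ (ℓ : ℝ) (γ : ℝ → EuclideanSpace ℝ (Fin n)),
        0 ≤ ℓ ∧ MapsTo γ (Icc 0 ℓ) G ∧ HasUnitSpeedOn γ (Icc 0 ℓ) ∧
        γ 0 = x ∧ γ ℓ = x₀ ∧ ℓ ≤ β * Metric.diam G ∧
        ∀ t ∈ Icc (0 : ℝ) ℓ, t / β ≤ Metric.infDist (γ t) (frontier G)

/-- The set of exponents `0 < t ≤ n` for which there is `C > 0` with
`∫_{B(x,r)} dist (y, E) ^ (t - n) dy ≤ C r ^ t` for all `x ∈ E` and `0 < r < ∞`.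
The integrand is `[0, ∞]`-valued: it is `∞` where `dist (y, E) = 0` and `t < n`. -/
def aikawaSet {n : ℕ} (E : Set (EuclideanSpace ℝ (Fin n))) : Set ℝ :=
  {t | 0 < t ∧ t ≤ n ∧ ∃ C : ℝ, 0 < C ∧ ∀ x ∈ E, ∀ r : ℝ, 0 < r →
    ∫⁻ y in Metric.ball x r, Metric.infEDist y E ^ (t - n) ≤ ENNReal.ofReal (C * r ^ t)}

/-- The Aikawa dimension of a (closed, with empty interior) set `E ⊆ ℝⁿ`. -/
def aikawaDim {n : ℕ} (E : Set (EuclideanSpace ℝ (Fin n))) : ℝ :=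
  sInf (aikawaSet E)

variable {𝕜 : Type*} [RCLike 𝕜]

/-- The seminorm
`|f|_{W^{s,p}(G)} = (∫_G ∫_G |f x - f y| ^ p / |x - y| ^ (n + s p) dy dx) ^ (1 / p)`,
with values in `[0, ∞]`. -/
def fracSeminorm {n : ℕ} (s p : ℝ) (G : Set (EuclideanSpace ℝ (Fin n)))
    (f : EuclideanSpace ℝ (Fin n) → 𝕜) : ℝ≥0∞ :=
  (∫⁻ x in G, ∫⁻ y in G, ‖f x - f y‖ₑ ^ p / edist x y ^ ((n : ℝ) + s * p)) ^ (1 / p)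

/-- The norm `‖f‖_{W^{s,p}(G)} = ‖f‖_{L^p(G)} + |f|_{W^{s,p}(G)}`, with values in `[0, ∞]`. -/
def fracNorm {n : ℕ} (s p : ℝ) (G : Set (EuclideanSpace ℝ (Fin n)))
    (f : EuclideanSpace ℝ (Fin n) → 𝕜) : ℝ≥0∞ :=
  eLpNorm f (ENNReal.ofReal p) (volume.restrict G) + fracSeminorm s p G f

/-- `f ∈ W^{s,p}(G)`: `f` is in `L^p(G)` and `‖f‖_{W^{s,p}(G)} < ∞`.
Only the values of `f` on `G` matter. -/
def MemFracSobolev {n : ℕ} (s p : ℝ) (G : Set (EuclideanSpace ℝ (Fin n)))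
    (f : EuclideanSpace ℝ (Fin n) → 𝕜) : Prop :=
  MemLp f (ENNReal.ofReal p) (volume.restrict G) ∧ fracNorm s p G f < ∞

/-- The zero extension `E₀ f`, equal to `f` on `G` and to `0` on `ℝⁿ \ G`. -/
def zeroExtension {n : ℕ} (G : Set (EuclideanSpace ℝ (Fin n)))
    (f : EuclideanSpace ℝ (Fin n) → 𝕜) : EuclideanSpace ℝ (Fin n) → 𝕜 :=
  G.indicator f

end FracSob

end

/-!
Let `d` be the distance to `∂G` and `F x = ∫_G |f x - f y| ^ p / |x - y| ^ (n + s p) dy`. Since the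
complement of `G` stays at distance at least `d x` from `x ∈ G`, the part of the seminorm of the
zero extension that is not already in the seminorm over `G` is at most a constant times
`∫_G |f| ^ p d ^ (-s p)` (`exists_lintegral_compl_le`,
`lintegral_gagliardoDensity_zeroExtension`). Everything thus rests on the fractional Hardy
inequality `∫_G |f| ^ p d ^ (-s p) ≤ C (∫_G |f| ^ p + ∫_G F)`, `exists_fractional_hardy`.

The John curve of a point `x` close to the boundary provides, at every scale
`ρ_k = 2 ^ k d x` below a fixed threshold, a ball `B_k ⊆ G` of radius comparable to `ρ_k`, with
centre at distance at most `ρ_k` from `x` and on which `d` is comparable to `ρ_k`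
(`IsJohnDomain.hasCorkscrews`). As the seminorm is nonlocal, Jensen's inequality compares the
averages of `f` over `B_k` and `B_{k+1}` directly, although the balls need not meet: the `p`-th
power of the difference is at most `C ρ_k ^ (s p - n) ∫_{B_k} F` (`chain_step`).

By the dimension hypothesis the Aikawa condition holds for some `t = n - s p - ε` with `ε > 0`.
On `B_k` one has `ρ_k ^ (s p - n) ≤ C ρ_k ^ (-ε) d ^ (-t)`, so the differences are at most
`2 ^ (-k ε / p)` times a quantity independent of `k`, and the chain sums as a geometric series
(`exists_enorm_rpow_le`). The last ball has a radius bounded below and is controlled by the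
`L^p` norm. It remains to integrate in `x` against `d ^ (-s p)`: by Tonelli's theorem the weight
falls on the set of `x` with `|x - y| ≤ C d y`, where the Aikawa condition bounds
`∫ d ^ (-s p - ε)` by `C (d y) ^ t` and cancels `d ^ (-t)` (`lintegral_mul_chainIntegral_le`).
-/

namespace FracSob

variable {n : ℕ} {𝕜 : Type*} [RCLike 𝕜]

/-! ### Averages over balls -/

theorem enorm_sub_integral_rpow_le {α : Type*} [MeasurableSpace α] {μ : Measure α}
    [IsProbabilityMeasure μ] {f : α → 𝕜} (hf : Integrable f μ) {p : ℝ} (hp : 1 ≤ p) (c : 𝕜) :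
    ‖c - ∫ y, f y ∂μ‖ₑ ^ p ≤ ∫⁻ y, ‖c - f y‖ₑ ^ p ∂μ := by
  have hp0 : 0 < p := by linarith
  have h1 : c - ∫ y, f y ∂μ = ∫ y, (c - f y) ∂μ := by
    rw [integral_sub (integrable_const c) hf]; simp
  have hm : AEStronglyMeasurable (fun y => c - f y) μ :=
    aestronglyMeasurable_const.sub hf.aestronglyMeasurable
  have h2 := eLpNorm_le_eLpNorm_of_exponent_le (p := 1) (q := ENNReal.ofReal p)
    (by simpa using hp) hm
  rw [eLpNorm_one_eq_lintegral_enorm, eLpNorm_eq_lintegral_rpow_enorm_toReal (by simpa using hp0)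
    ENNReal.ofReal_ne_top, ENNReal.toReal_ofReal hp0.le] at h2
  calc ‖c - ∫ y, f y ∂μ‖ₑ ^ p ≤ (∫⁻ y, ‖c - f y‖ₑ ∂μ) ^ p := by
        rw [h1]; gcongr; exact enorm_integral_le_lintegral_enorm _
    _ ≤ ((∫⁻ y, ‖c - f y‖ₑ ^ p ∂μ) ^ (1 / p)) ^ p := by gcongr
    _ = _ := by rw [← ENNReal.rpow_mul, one_div_mul_cancel hp0.ne', ENNReal.rpow_one]

/-- Jensen's inequality for the average over a ball. -/
theorem enorm_sub_average_ball_rpow_le {f : EuclideanSpace ℝ (Fin n) → 𝕜}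
    {c : EuclideanSpace ℝ (Fin n)} {r : ℝ} (hr : 0 < r)
    (hf : IntegrableOn f (Metric.ball c r)) {p : ℝ} (hp : 1 ≤ p) (a : 𝕜) :
    ‖a - ⨍ y in Metric.ball c r, f y‖ₑ ^ p ≤
      (volume (Metric.ball c r))⁻¹ * ∫⁻ y in Metric.ball c r, ‖a - f y‖ₑ ^ p := by
  have h0 : volume (Metric.ball c r) ≠ 0 := (Metric.measure_ball_pos _ _ hr).ne'
  have h1 : volume (Metric.ball c r) ≠ ∞ := measure_ball_lt_top.ne
  have : NeZero (volume.restrict (Metric.ball c r)) := ⟨by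
    rwa [Ne, Measure.restrict_eq_zero]⟩
  have : IsFiniteMeasure (volume.restrict (Metric.ball c r)) := ⟨by
    simpa using measure_ball_lt_top⟩
  have hint : Integrable f ((volume.restrict (Metric.ball c r) univ)⁻¹ •
      volume.restrict (Metric.ball c r)) := by
    refine Integrable.smul_measure hf ?_
    simpa using h0
  refine (enorm_sub_integral_rpow_le hint hp a).trans_eq ?_
  rw [lintegral_smul_measure]
  simp

/-! ### Oscillation bounds by the Gagliardo density -/

/-- The Gagliardo density
`y ↦ ∫_G |f y - f z| ^ p / |y - z| ^ (n + s p) dz`, whose integral over `G` is the `p`-th power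
of the seminorm. -/
noncomputable def gagliardoDensity (s p : ℝ) (G : Set (EuclideanSpace ℝ (Fin n)))
    (f : EuclideanSpace ℝ (Fin n) → 𝕜) (x : EuclideanSpace ℝ (Fin n)) : ℝ≥0∞ :=
  ∫⁻ y in G, ‖f x - f y‖ₑ ^ p / edist x y ^ ((n : ℝ) + s * p)

theorem measurable_gagliardo_integrand {f : EuclideanSpace ℝ (Fin n) → 𝕜} (hf : Measurable f)
    (s p : ℝ) :
    Measurable fun z : EuclideanSpace ℝ (Fin n) × EuclideanSpace ℝ (Fin n) =>
      ‖f z.1 - f z.2‖ₑ ^ p / edist z.1 z.2 ^ ((n : ℝ) + s * p) := by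
  have h1 : Measurable fun z : EuclideanSpace ℝ (Fin n) × EuclideanSpace ℝ (Fin n) =>
      ‖f z.1 - f z.2‖ₑ := ((hf.comp measurable_fst).sub (hf.comp measurable_snd)).enorm
  have h2 : Measurable fun z : EuclideanSpace ℝ (Fin n) × EuclideanSpace ℝ (Fin n) =>
      edist z.1 z.2 := measurable_edist
  exact (h1.pow_const _).div (h2.pow_const _)

theorem measurable_gagliardoDensity {f : EuclideanSpace ℝ (Fin n) → 𝕜} (hf : Measurable f)
    (s p : ℝ) (G : Set (EuclideanSpace ℝ (Fin n))) :
    Measurable (gagliardoDensity s p G f) :=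
  (measurable_gagliardo_integrand hf s p).lintegral_prod_right'

theorem rpow_enorm_sub_le_mul_div {f : EuclideanSpace ℝ (Fin n) → 𝕜} {p q : ℝ}
    (hp : 0 < p) (hq : 0 < q) {R : ℝ≥0∞} {x y : EuclideanSpace ℝ (Fin n)} (h : edist x y ≤ R) :
    ‖f x - f y‖ₑ ^ p ≤ R ^ q * (‖f x - f y‖ₑ ^ p / edist x y ^ q) := by
  -- On the diagonal the quotient is `0 / 0`, which is harmless: the left-hand side vanishes too.
  rcases eq_or_ne x y with rfl | hxy
  · simp [hp]
  · have h0 : edist x y ^ q ≠ 0 := by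
      simp [ENNReal.rpow_eq_zero_iff, hxy, edist_ne_top]
    have h1 : edist x y ^ q ≠ ∞ := ENNReal.rpow_ne_top_of_nonneg hq.le (edist_ne_top _ _)
    calc ‖f x - f y‖ₑ ^ p = edist x y ^ q * (‖f x - f y‖ₑ ^ p / edist x y ^ q) :=
          (ENNReal.mul_div_cancel h0 h1).symm
      _ ≤ _ := by gcongr

variable {s p : ℝ} {G : Set (EuclideanSpace ℝ (Fin n))} {f : EuclideanSpace ℝ (Fin n) → 𝕜}

theorem lintegral_rpow_sub_le_gagliardoDensity (hs : 0 < s) (hp : 0 < p)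
    {x : EuclideanSpace ℝ (Fin n)} {A : Set (EuclideanSpace ℝ (Fin n))} (hA : A ⊆ G)
    (hAm : MeasurableSet A) {R : ℝ≥0∞} (hRt : R ≠ ∞)
    (hR : ∀ y ∈ A, edist x y ≤ R) :
    ∫⁻ y in A, ‖f x - f y‖ₑ ^ p ≤ R ^ ((n : ℝ) + s * p) * gagliardoDensity s p G f x := by
  have hq : 0 < (n : ℝ) + s * p := by positivity
  calc ∫⁻ y in A, ‖f x - f y‖ₑ ^ p
      ≤ ∫⁻ y in A, R ^ ((n : ℝ) + s * p) * (‖f x - f y‖ₑ ^ p / edist x y ^ ((n : ℝ) + s * p)) :=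
        setLIntegral_mono' hAm fun y hy => rpow_enorm_sub_le_mul_div hp hq (hR y hy)
    _ = R ^ ((n : ℝ) + s * p) *
          ∫⁻ y in A, ‖f x - f y‖ₑ ^ p / edist x y ^ ((n : ℝ) + s * p) :=
        lintegral_const_mul' _ _ (ENNReal.rpow_ne_top_of_nonneg hq.le hRt)
    _ ≤ _ := by gcongr; exact lintegral_mono_set hA

theorem volume_ball_mul {ρ : ℝ} (hρ : 0 < ρ) (c : EuclideanSpace ℝ (Fin n)) (a : ℝ) :
    volume (Metric.ball c (ρ * a)) =
      ENNReal.ofReal ρ ^ (n : ℝ) * volume (Metric.ball (0 : EuclideanSpace ℝ (Fin n)) a) := by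
  rw [Measure.addHaar_ball_mul_of_pos _ _ hρ, finrank_euclideanSpace_fin,
    ENNReal.rpow_natCast, ENNReal.ofReal_pow hρ.le]

theorem enorm_sub_average_le_gagliardoDensity (hs : 0 < s) (hp : 1 ≤ p)
    {x c : EuclideanSpace ℝ (Fin n)} {r : ℝ} (hr : 0 < r) (hf : IntegrableOn f G)
    (hB : Metric.ball c r ⊆ G) {R : ℝ≥0∞} (hRt : R ≠ ∞)
    (hR : ∀ y ∈ Metric.ball c r, edist x y ≤ R) :
    ‖f x - ⨍ y in Metric.ball c r, f y‖ₑ ^ p ≤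
      (volume (Metric.ball c r))⁻¹ *
        (R ^ ((n : ℝ) + s * p) * gagliardoDensity s p G f x) := by
  refine (enorm_sub_average_ball_rpow_le hr (hf.mono_set hB) hp _).trans ?_
  gcongr
  exact lintegral_rpow_sub_le_gagliardoDensity hs (by linarith) hB measurableSet_ball hRt hR

/-- The two balls need neither meet nor lie in a common ball inside `G`: the double integral of
the seminorm runs over all pairs of points of `G`. -/
theorem enorm_average_sub_average_le_gagliardoDensity (hs : 0 < s) (hp : 1 ≤ p)
    {c c' : EuclideanSpace ℝ (Fin n)} {r r' : ℝ} (hr : 0 < r) (hr' : 0 < r')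
    (hf : IntegrableOn f G)
    (hB : Metric.ball c r ⊆ G) (hB' : Metric.ball c' r' ⊆ G) {R : ℝ≥0∞} (hRt : R ≠ ∞)
    (hR : ∀ y ∈ Metric.ball c r, ∀ z ∈ Metric.ball c' r', edist y z ≤ R) :
    ‖(⨍ y in Metric.ball c r, f y) - ⨍ y in Metric.ball c' r', f y‖ₑ ^ p ≤
      (volume (Metric.ball c r))⁻¹ * ((volume (Metric.ball c' r'))⁻¹ *
        (R ^ ((n : ℝ) + s * p) * ∫⁻ y in Metric.ball c r, gagliardoDensity s p G f y)) := by
  have hq : 0 ≤ (n : ℝ) + s * p := by positivity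
  rw [← enorm_neg, neg_sub]
  refine (enorm_sub_average_ball_rpow_le hr (hf.mono_set hB) hp _).trans ?_
  gcongr
  rw [← lintegral_const_mul' _ _ (ENNReal.rpow_ne_top_of_nonneg hq hRt),
    ← lintegral_const_mul' _ _
      (ENNReal.inv_ne_top.2 (Metric.measure_ball_pos _ _ hr').ne')]
  refine setLIntegral_mono' measurableSet_ball fun y hy => ?_
  rw [← enorm_neg, neg_sub]
  exact enorm_sub_average_le_gagliardoDensity hs hp hr' hf hB' hRt (hR y hy)

/-! ### Distance to the boundary -/

theorem infDist_frontier_le_dist {x y : EuclideanSpace ℝ (Fin n)}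
    (hx : x ∈ G) (hy : y ∉ G) : Metric.infDist x (frontier G) ≤ dist x y := by
  obtain ⟨z, hz, hxz⟩ := exists_mem_frontier_infDist_compl_eq_dist hx
    (fun h => hy (h ▸ mem_univ y))
  calc Metric.infDist x (frontier G) ≤ dist x z := Metric.infDist_le_dist_of_mem hz
    _ = Metric.infDist x Gᶜ := hxz.symm
    _ ≤ dist x y := Metric.infDist_le_dist_of_mem hy

theorem ball_subset_of_le_infDist_frontier {c : EuclideanSpace ℝ (Fin n)}
    (hc : c ∈ G) {r : ℝ} (hr : r ≤ Metric.infDist c (frontier G)) : Metric.ball c r ⊆ G := by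
  intro y hy
  by_contra h
  have := infDist_frontier_le_dist hc h
  rw [Metric.mem_ball, dist_comm] at hy
  linarith

theorem infEDist_frontier_eq_ofReal (hne : (frontier G).Nonempty)
    (x : EuclideanSpace ℝ (Fin n)) :
    Metric.infEDist x (frontier G) = ENNReal.ofReal (Metric.infDist x (frontier G)) :=
  (ENNReal.ofReal_toReal (Metric.infEDist_ne_top hne)).symm

theorem infDist_frontier_pos (hG : IsOpen G) (hne : (frontier G).Nonempty)
    {x : EuclideanSpace ℝ (Fin n)} (hx : x ∈ G) : 0 < Metric.infDist x (frontier G) := by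
  rw [← isClosed_frontier.notMem_iff_infDist_pos hne]
  intro h
  rw [hG.frontier_eq] at h
  exact h.2 hx

/-! ### Consecutive averages in a chain of balls -/

/-- The weighted integral of the Gagliardo density over the part of `G` that sees `x` at a
distance controlled by the distance to the boundary; it dominates all terms of the chain of
averages that starts at `x`. -/
noncomputable def chainIntegral (s p t κ : ℝ) (G : Set (EuclideanSpace ℝ (Fin n)))
    (f : EuclideanSpace ℝ (Fin n) → 𝕜) (x : EuclideanSpace ℝ (Fin n)) : ℝ≥0∞ :=
  ∫⁻ y in G ∩ {y | dist x y ≤ κ * Metric.infDist y (frontier G)},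
    Metric.infEDist y (frontier G) ^ (-t) * gagliardoDensity s p G f y

/-- One step of the chain at `x`, from the scale `ρ` to the scale `2 ρ`. The radii `ρ / (2 β)` and
`ρ / β` are half of the guaranteed distances of the centres to the boundary, so that on the first
ball the distance to the boundary lies between `ρ / (2 β)` and `3 ρ`. The powers of `ρ` add up to
`-2 n + (n + s p) + t = -ε`. -/
theorem chain_step (hs : 0 < s) (hp : 1 ≤ p) (hG : IsOpen G) (hne : (frontier G).Nonempty)
    (hf : IntegrableOn f G) {t ε : ℝ} (ht : 0 < t) (hε : t + ε = n - s * p)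
    {β : ℝ} (hβ : 1 ≤ β) {ρ : ℝ} (hρ : 0 < ρ) {x c c' : EuclideanSpace ℝ (Fin n)}
    (hx : Metric.infDist x (frontier G) ≤ ρ)
    (hc : c ∈ G) (hc' : c' ∈ G) (hxc : dist x c ≤ ρ) (hxc' : dist x c' ≤ 2 * ρ)
    (hcd : ρ / β ≤ Metric.infDist c (frontier G))
    (hcd' : 2 * ρ / β ≤ Metric.infDist c' (frontier G)) :
    ‖(⨍ y in Metric.ball c (ρ * (2 * β)⁻¹), f y) -
        ⨍ y in Metric.ball c' (ρ * β⁻¹), f y‖ₑ ^ p ≤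
      ((volume (Metric.ball (0 : EuclideanSpace ℝ (Fin n)) (2 * β)⁻¹))⁻¹ *
        (volume (Metric.ball (0 : EuclideanSpace ℝ (Fin n)) β⁻¹))⁻¹ *
        5 ^ ((n : ℝ) + s * p) * 3 ^ t) * ENNReal.ofReal ρ ^ (-ε) *
        chainIntegral s p t (4 * β) G f x := by
  have hβ0 : 0 < β := by linarith
  have hq : 0 ≤ (n : ℝ) + s * p := by positivity
  have hρβ : ρ / β ≤ ρ := div_le_self hρ.le hβ
  have e1 : ρ * (2 * β)⁻¹ = ρ / β / 2 := by field_simp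
  have e2 : ρ * β⁻¹ = ρ / β := by field_simp
  have hρβ0 : 0 < ρ / β := by positivity
  set P := ENNReal.ofReal ρ with hP
  have hP0 : P ≠ 0 := by simpa [hP] using hρ
  have hPt : P ≠ ∞ := ENNReal.ofReal_ne_top
  have hsub : Metric.ball c (ρ * (2 * β)⁻¹) ⊆ G :=
    ball_subset_of_le_infDist_frontier hc (by rw [e1]; linarith)
  have hsub' : Metric.ball c' (ρ * β⁻¹) ⊆ G :=
    ball_subset_of_le_infDist_frontier hc' (by
      rw [e2]; have : 2 * ρ / β = 2 * (ρ / β) := by ring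
      linarith)
  have h5 : ENNReal.ofReal (5 * ρ) = 5 * P := by
    rw [ENNReal.ofReal_mul (by norm_num)]; norm_num [hP]
  have h3 : ENNReal.ofReal (3 * ρ) = 3 * P := by
    rw [ENNReal.ofReal_mul (by norm_num)]; norm_num [hP]
  have hmain := enorm_average_sub_average_le_gagliardoDensity (R := 5 * P) hs hp
    (by positivity) (by positivity) hf hsub hsub' (by rw [← h5]; exact ENNReal.ofReal_ne_top) (by
      intro y hy z hz
      rw [← h5, edist_dist]
      refine ENNReal.ofReal_le_ofReal ?_
      rw [Metric.mem_ball, e1] at hy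
      rw [Metric.mem_ball, e2] at hz
      have h1 := dist_triangle4 y c x z
      have h2 := dist_triangle x c' z
      rw [dist_comm c x] at h1
      rw [dist_comm z c'] at hz
      linarith)
  -- On the first ball the distance to the boundary is comparable to `ρ`.
  have hint : ∫⁻ y in Metric.ball c (ρ * (2 * β)⁻¹), gagliardoDensity s p G f y ≤
      (3 * P) ^ t * chainIntegral s p t (4 * β) G f x := by
    rw [chainIntegral, ← lintegral_const_mul' _ _
      (ENNReal.rpow_ne_top_of_nonneg ht.le (by rw [← h3]; exact ENNReal.ofReal_ne_top))]
    refine (setLIntegral_mono' measurableSet_ball fun y hy => ?_).trans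
      (lintegral_mono_set (s := Metric.ball c (ρ * (2 * β)⁻¹)) fun y hy => ⟨hsub hy, ?_⟩)
    · have hyG := hsub hy
      have hd0 := infDist_frontier_pos hG hne hyG
      have hle : Metric.infDist y (frontier G) ≤ 3 * ρ := by
        rw [Metric.mem_ball, e1] at hy
        have h1 : Metric.infDist y (frontier G) ≤ Metric.infDist x (frontier G) + dist y x :=
          Metric.infDist_le_infDist_add_dist
        have h2 := dist_triangle_right y x c
        linarith
      have hD0 : Metric.infEDist y (frontier G) ≠ 0 := by
        rw [infEDist_frontier_eq_ofReal hne]; simpa using hd0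
      have hDt : Metric.infEDist y (frontier G) ≠ ∞ := Metric.infEDist_ne_top hne
      calc gagliardoDensity s p G f y
          = Metric.infEDist y (frontier G) ^ t * Metric.infEDist y (frontier G) ^ (-t) *
              gagliardoDensity s p G f y := by
            rw [← ENNReal.rpow_add _ _ hD0 hDt]; simp
        _ ≤ (3 * P) ^ t * Metric.infEDist y (frontier G) ^ (-t) *
              gagliardoDensity s p G f y := by
            gcongr
            rw [infEDist_frontier_eq_ofReal hne, ← h3]
            exact ENNReal.ofReal_le_ofReal hle
        _ = _ := mul_assoc _ _ _
    · rw [Metric.mem_ball, e1] at hy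
      have h1 : Metric.infDist c (frontier G) ≤ Metric.infDist y (frontier G) + dist c y :=
        Metric.infDist_le_infDist_add_dist
      rw [dist_comm] at hy
      have h2 := dist_triangle x c y
      have h3 : ρ / β / 2 ≤ Metric.infDist y (frontier G) := by linarith
      have h4 : 4 * β * (ρ / β / 2) = 2 * ρ := by field_simp; norm_num
      have h5 := mul_le_mul_of_nonneg_left h3 (by positivity : 0 ≤ 4 * β)
      rw [mem_ofPred_eq]
      linarith
  refine hmain.trans ?_
  rw [volume_ball_mul hρ, volume_ball_mul hρ]
  have hPn0 : P ^ (n : ℝ) ≠ 0 := (ENNReal.rpow_pos (pos_iff_ne_zero.2 hP0) hPt).ne'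
  have hPnt : P ^ (n : ℝ) ≠ ∞ := ENNReal.rpow_ne_top_of_nonneg (by positivity) hPt
  rw [ENNReal.mul_inv (Or.inl hPn0) (Or.inl hPnt), ENNReal.mul_inv (Or.inl hPn0) (Or.inl hPnt),
    ENNReal.mul_rpow_of_nonneg _ _ hq, ← ENNReal.rpow_neg]
  have hexp : P ^ (-ε) = P ^ (-(n : ℝ)) * P ^ (-(n : ℝ)) * P ^ ((n : ℝ) + s * p) * P ^ t := by
    rw [← ENNReal.rpow_add _ _ hP0 hPt, ← ENNReal.rpow_add _ _ hP0 hPt,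
      ← ENNReal.rpow_add _ _ hP0 hPt]
    congr 1; linarith
  rw [ENNReal.mul_rpow_of_nonneg _ _ ht.le] at hint
  rw [hexp]
  refine (mul_le_mul_right (mul_le_mul_right (mul_le_mul_right hint _) _) _).trans_eq ?_
  ring

/-! ### Interior corkscrews and the pointwise estimate -/

/-- The interior corkscrew condition on scales up to `δ`, with constant `β`, at the points whose
distance to the boundary is less than `δ`. -/
def HasCorkscrews (G : Set (EuclideanSpace ℝ (Fin n))) (δ β : ℝ) : Prop :=
  ∀ x ∈ G, Metric.infDist x (frontier G) < δ → ∀ ρ : ℝ, 0 < ρ → ρ ≤ δ →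
    ∃ c ∈ G, dist x c ≤ ρ ∧ ρ / β ≤ Metric.infDist c (frontier G)

/-- A John domain has interior corkscrews: the centre for the scale `ρ` at `x` is the point at
arc length `ρ` on the John curve of `x`, and a point close to the boundary has a long curve. -/
theorem IsJohnDomain.hasCorkscrews (hG : IsJohnDomain G) (hne : (frontier G).Nonempty) :
    ∃ δ β : ℝ, 0 < δ ∧ 1 ≤ β ∧ HasCorkscrews G δ β := by
  obtain ⟨hopen, -, -, x₀, hx₀, β, hβ, hγ⟩ := hG
  have hd0 := infDist_frontier_pos hopen hne hx₀
  -- If `d x < d x₀ / 2`, then the John curve has length at least `|x - x₀| ≥ d x₀ / 2`.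
  refine ⟨Metric.infDist x₀ (frontier G) / 2, β, by positivity, hβ, ?_⟩
  intro x hx hxd ρ hρ hρδ
  obtain ⟨ℓ, γ, hℓ, hmaps, hspeed, h0, h1, -, hdist⟩ := hγ x hx
  have hlip : ∀ u ∈ Icc 0 ℓ, dist x (γ u) ≤ u := by
    intro u hu
    have h2 := eVariationOn.edist_le γ (s := Icc 0 ℓ ∩ Icc 0 u)
      (x := 0) (y := u) ⟨⟨le_rfl, hℓ⟩, ⟨le_rfl, hu.1⟩⟩ ⟨hu, ⟨hu.1, le_rfl⟩⟩
    rw [hspeed ⟨le_rfl, hℓ⟩ hu, h0] at h2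
    simp only [NNReal.coe_one, one_mul, sub_zero] at h2
    rwa [edist_dist, ENNReal.ofReal_le_ofReal_iff hu.1] at h2
  have hℓδ : ρ ≤ ℓ := by
    have h2 := hlip ℓ ⟨hℓ, le_rfl⟩
    rw [h1] at h2
    have h3 : Metric.infDist x₀ (frontier G) ≤ Metric.infDist x (frontier G) + dist x₀ x :=
      Metric.infDist_le_infDist_add_dist
    rw [dist_comm] at h3
    linarith
  exact ⟨γ ρ, hmaps ⟨hρ.le, hℓδ⟩, hlip ρ ⟨hρ.le, hℓδ⟩, hdist ρ ⟨hρ.le, hℓδ⟩⟩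

/-- Pointwise estimate behind the Hardy inequality. A chain of balls of radii comparable to
`2 ^ k * dist (x, ∂G)` leads from `x` to a ball of fixed size; consecutive averages of `f` differ
by terms that decay geometrically in `k`. -/
theorem exists_enorm_rpow_le (hs : 0 < s) (hp : 1 ≤ p) (hG : IsOpen G)
    (hne : (frontier G).Nonempty) {t ε : ℝ} (ht : 0 < t) (hε0 : 0 < ε)
    (hε : t + ε = n - s * p) {δ β : ℝ} (hδ : 0 < δ) (hβ : 1 ≤ β) (hcork : HasCorkscrews G δ β) :
    ∃ C : ℝ≥0∞, C ≠ ∞ ∧ ∀ f : EuclideanSpace ℝ (Fin n) → 𝕜, IntegrableOn f G →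
      ∀ x ∈ G, Metric.infDist x (frontier G) < δ →
        ‖f x‖ₑ ^ p ≤ C * (Metric.infEDist x (frontier G) ^ (s * p) * gagliardoDensity s p G f x +
          Metric.infEDist x (frontier G) ^ (-ε) * chainIntegral s p t (4 * β) G f x +
          ∫⁻ y in G, ‖f y‖ₑ ^ p) := by
  have hβ0 : 0 < β := by linarith
  have hp0 : 0 < p := by linarith
  have hq : 0 ≤ (n : ℝ) + s * p := by positivity
  set V : ℝ → ℝ≥0∞ := fun a => (volume (Metric.ball (0 : EuclideanSpace ℝ (Fin n)) a))⁻¹ with hV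
  have hVt : ∀ {a : ℝ}, 0 < a → V a ≠ ∞ := fun ha =>
    ENNReal.inv_ne_top.2 (Metric.measure_ball_pos _ _ ha).ne'
  -- The ratio of the geometric series.
  set q : ℝ≥0∞ := 2 ^ (-ε / p) with hqdef
  have hq1 : q < 1 := ENNReal.rpow_lt_one_of_one_lt_of_neg (by norm_num)
    (div_neg_of_neg_of_pos (by linarith) hp0)
  set C₁ : ℝ≥0∞ := V (2 * β)⁻¹ * 2 ^ ((n : ℝ) + s * p) with hC₁
  set C₂ : ℝ≥0∞ := V (2 * β)⁻¹ * V β⁻¹ * 5 ^ ((n : ℝ) + s * p) * 3 ^ t with hC₂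
  set C₃ : ℝ≥0∞ := V (δ / (4 * β)) with hC₃
  have h1q : (1 - q)⁻¹ ^ p ≠ ∞ := ENNReal.rpow_ne_top_of_nonneg hp0.le
    (ENNReal.inv_ne_top.2 (tsub_pos_of_lt hq1).ne')
  have hC₁t : C₁ ≠ ∞ := ENNReal.mul_ne_top (hVt (by positivity))
    (ENNReal.rpow_ne_top_of_nonneg hq (by norm_num))
  have hC₂t : C₂ ≠ ∞ := ENNReal.mul_ne_top (ENNReal.mul_ne_top (ENNReal.mul_ne_top
    (hVt (by positivity)) (hVt (by positivity)))
    (ENNReal.rpow_ne_top_of_nonneg hq (by norm_num)))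
    (ENNReal.rpow_ne_top_of_nonneg ht.le (by norm_num))
  have hC₃t : C₃ ≠ ∞ := hVt (by positivity)
  have h2p : (2 : ℝ≥0∞) ^ (p - 1) ≠ ∞ :=
    ENNReal.rpow_ne_top_of_nonneg (by linarith) (by norm_num)
  refine ⟨2 ^ (p - 1) * (2 ^ (p - 1) * (C₁ + (1 - q)⁻¹ ^ p * C₂) + C₃),
    by finiteness, ?_⟩
  intro f hf x hx hxδ
  have hd0 := infDist_frontier_pos hG hne hx
  rw [infEDist_frontier_eq_ofReal hne]
  set d := Metric.infDist x (frontier G) with hd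
  set D := ENNReal.ofReal d with hD
  have hD0 : D ≠ 0 := by simpa [hD] using hd0
  have hDt : D ≠ ∞ := ENNReal.ofReal_ne_top
  -- The last scale `2 ^ N * d` lies in `(δ / 2, δ]`.
  obtain ⟨N, hN1, hN2⟩ := exists_nat_pow_near (x := δ / d) (y := (2 : ℝ))
    (by rw [one_le_div hd0]; exact hxδ.le) (by norm_num)
  rw [le_div_iff₀ hd0] at hN1
  rw [div_lt_iff₀ hd0] at hN2
  have hρ : ∀ k : ℕ, 0 < 2 ^ k * d := fun k => by positivity
  have hρδ : ∀ k ≤ N, 2 ^ k * d ≤ δ := fun k hk => le_trans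
    (mul_le_mul_of_nonneg_right (pow_le_pow_right₀ (by norm_num) hk) hd0.le) hN1
  have hex : ∀ k : ℕ, ∃ c, k ≤ N → c ∈ G ∧ dist x c ≤ 2 ^ k * d ∧
      2 ^ k * d / β ≤ Metric.infDist c (frontier G) := by
    intro k
    by_cases hk : k ≤ N
    · obtain ⟨c, h1, h2, h3⟩ := hcork x hx hxδ _ (hρ k) (hρδ k hk)
      exact ⟨c, fun _ => ⟨h1, h2, h3⟩⟩
    · exact ⟨x, fun h => absurd h hk⟩
  choose c hc using hex
  set r : ℕ → ℝ := fun k => 2 ^ k * d * (2 * β)⁻¹ with hr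
  have hr0 : ∀ k, 0 < r k := fun k => by have := hρ k; positivity
  have hball : ∀ k ≤ N, Metric.ball (c k) (r k) ⊆ G := by
    intro k hk
    refine ball_subset_of_le_infDist_frontier (hc k hk).1 (le_trans ?_ (hc k hk).2.2)
    have := hρ k
    have e : r k = 2 ^ k * d / β / 2 := by simp only [hr]; field_simp
    have : 0 < 2 ^ k * d / β := by positivity
    linarith
  set a : ℕ → 𝕜 := fun k => ⨍ y in Metric.ball (c k) (r k), f y with ha
  set T := chainIntegral s p t (4 * β) G f x with hT
  set F := gagliardoDensity s p G f x with hF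
  -- First term: from `f x` to the average over the first ball.
  have hfirst : ‖f x - a 0‖ₑ ^ p ≤ C₁ * (D ^ (s * p) * F) := by
    have h0 := hc 0 (Nat.zero_le N)
    have h2D : ENNReal.ofReal (2 * d) = 2 * D := by
      rw [ENNReal.ofReal_mul (by norm_num)]; norm_num [hD]
    refine (enorm_sub_average_le_gagliardoDensity (R := 2 * D) hs hp (hr0 0) hf
      (hball 0 (Nat.zero_le N)) (by finiteness) ?_).trans_eq ?_
    · intro y hy
      rw [← h2D, edist_dist]
      refine ENNReal.ofReal_le_ofReal ?_
      rw [Metric.mem_ball, dist_comm] at hy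
      have h2 := dist_triangle x (c 0) y
      have h3 : r 0 ≤ d := by
        simp only [hr, pow_zero, one_mul]
        refine mul_le_of_le_one_right hd0.le (inv_le_one_of_one_le₀ (by linarith))
      have h4 := h0.2.1
      rw [pow_zero, one_mul] at h4
      linarith
    · have e : r 0 = d * (2 * β)⁻¹ := by simp [hr]
      have hDn0 : D ^ (n : ℝ) ≠ 0 := (ENNReal.rpow_pos (pos_iff_ne_zero.2 hD0) hDt).ne'
      have hDnt : D ^ (n : ℝ) ≠ ∞ := ENNReal.rpow_ne_top_of_nonneg (by positivity) hDt
      rw [e, volume_ball_mul hd0, ENNReal.mul_inv (Or.inl hDn0) (Or.inl hDnt),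
        ENNReal.mul_rpow_of_nonneg _ _ hq, ENNReal.rpow_add _ _ hD0 hDt]
      calc (D ^ (n : ℝ))⁻¹ * V (2 * β)⁻¹ *
            (2 ^ ((n : ℝ) + s * p) * (D ^ (n : ℝ) * D ^ (s * p)) * F)
          = ((D ^ (n : ℝ))⁻¹ * D ^ (n : ℝ)) * (C₁ * (D ^ (s * p) * F)) := by
            rw [hC₁]; ring
        _ = _ := by rw [ENNReal.inv_mul_cancel hDn0 hDnt, one_mul]
  -- Second term: the geometric sum along the chain.
  have hstep : ∀ {k : ℕ}, k < N → edist (a k) (a (k + 1)) ≤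
      q ^ k * (C₂ * D ^ (-ε) * T) ^ (1 / p) := by
    intro k hk
    have h1 := hc k hk.le
    have h2 := hc (k + 1) hk
    have e : 2 ^ (k + 1) * d = 2 * (2 ^ k * d) := by ring
    have e' : r (k + 1) = 2 ^ k * d * β⁻¹ := by simp only [hr, pow_succ]; field_simp
    rw [e] at h2
    have h3 := chain_step hs hp hG hne hf ht hε hβ (hρ k)
      (le_mul_of_one_le_left hd0.le (one_le_pow₀ (by norm_num))) h1.1 h2.1 h1.2.1 h2.2.1
      h1.2.2 h2.2.2
    have e2 : ENNReal.ofReal (2 ^ k * d) = 2 ^ (k : ℝ) * D := by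
      rw [ENNReal.ofReal_mul (by positivity), ENNReal.ofReal_pow (by norm_num),
        ENNReal.rpow_natCast]
      norm_num [hD]
    have hpow : q ^ k = (((2 : ℝ≥0∞) ^ (k : ℝ)) ^ (-ε)) ^ (1 / p) := by
      rw [hqdef, ← ENNReal.rpow_natCast, ← ENNReal.rpow_mul, ← ENNReal.rpow_mul,
        ← ENNReal.rpow_mul]
      congr 1; field_simp
    rw [hpow, ← ENNReal.mul_rpow_of_nonneg _ _ (by positivity), edist_eq_enorm_sub,
      one_div, ENNReal.le_rpow_inv_iff hp0]
    simp only [ha]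
    rw [e']
    refine h3.trans_eq ?_
    rw [e2, ENNReal.mul_rpow_of_ne_zero (by simp) hD0]
    change C₂ * _ * T = _
    ring
  have hsum : ‖a 0 - a N‖ₑ ^ p ≤ (1 - q)⁻¹ ^ p * C₂ * (D ^ (-ε) * T) := by
    have h1 := edist_le_range_sum_of_edist_le N hstep
    rw [← Finset.sum_mul, edist_eq_enorm_sub] at h1
    have h2 : ∑ k ∈ Finset.range N, q ^ k ≤ (1 - q)⁻¹ := by
      rw [← ENNReal.tsum_geometric]; exact ENNReal.sum_le_tsum _
    calc ‖a 0 - a N‖ₑ ^ p ≤ ((1 - q)⁻¹ * (C₂ * D ^ (-ε) * T) ^ (1 / p)) ^ p := by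
          gcongr; exact h1.trans (by gcongr)
      _ = (1 - q)⁻¹ ^ p * (C₂ * D ^ (-ε) * T) := by
          rw [ENNReal.mul_rpow_of_nonneg _ _ hp0.le, ← ENNReal.rpow_mul,
            one_div_mul_cancel hp0.ne', ENNReal.rpow_one]
      _ = _ := by ring
  -- Third term: the last ball has radius at least `δ / (4 β)`.
  have hlast : ‖a N‖ₑ ^ p ≤ C₃ * ∫⁻ y in G, ‖f y‖ₑ ^ p := by
    have h1 := enorm_sub_average_ball_rpow_le (hr0 N) (hf.mono_set (hball N le_rfl)) hp 0
    simp only [zero_sub, enorm_neg] at h1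
    refine h1.trans ?_
    have h2 : δ / (4 * β) ≤ r N := by
      have : r N = 2 ^ (N + 1) * d / (4 * β) := by simp only [hr, pow_succ]; field_simp; norm_num
      rw [this]
      gcongr
    have h3 : (volume (Metric.ball (c N) (r N)))⁻¹ ≤ C₃ := by
      rw [hC₃, hV]
      simp only
      rw [ENNReal.inv_le_inv, ← Measure.addHaar_ball_center volume (c N)]
      exact measure_mono (Metric.ball_subset_ball h2)
    exact mul_le_mul' h3 (lintegral_mono_set (hball N le_rfl))
  have hsplit : ‖f x‖ₑ ^ p ≤ 2 ^ (p - 1) * (2 ^ (p - 1) * (‖f x - a 0‖ₑ ^ p +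
      ‖a 0 - a N‖ₑ ^ p) + ‖a N‖ₑ ^ p) := by
    have h1 : ‖f x‖ₑ ≤ (‖f x - a 0‖ₑ + ‖a 0 - a N‖ₑ) + ‖a N‖ₑ := by
      calc ‖f x‖ₑ = ‖(f x - a 0) + (a 0 - a N) + a N‖ₑ := by congr 1; ring
        _ ≤ _ := (enorm_add_le _ _).trans (by gcongr; exact enorm_add_le _ _)
    calc ‖f x‖ₑ ^ p ≤ ((‖f x - a 0‖ₑ + ‖a 0 - a N‖ₑ) + ‖a N‖ₑ) ^ p := by gcongr
      _ ≤ 2 ^ (p - 1) * ((‖f x - a 0‖ₑ + ‖a 0 - a N‖ₑ) ^ p + ‖a N‖ₑ ^ p) :=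
          ENNReal.rpow_add_le_mul_rpow_add_rpow _ _ hp
      _ ≤ _ := by gcongr; exact ENNReal.rpow_add_le_mul_rpow_add_rpow _ _ hp
  set X := D ^ (s * p) * F
  set Y := D ^ (-ε) * T
  set Z := ∫⁻ y in G, ‖f y‖ₑ ^ p
  have hX : X ≤ X + Y + Z := by rw [add_assoc]; exact le_self_add
  have hY : Y ≤ X + Y + Z := by rw [add_right_comm]; exact le_add_self
  have hZ : Z ≤ X + Y + Z := le_add_self
  calc ‖f x‖ₑ ^ p ≤ 2 ^ (p - 1) * (2 ^ (p - 1) * (C₁ * X + (1 - q)⁻¹ ^ p * C₂ * Y) + C₃ * Z) := by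
        refine hsplit.trans ?_
        gcongr
    _ ≤ 2 ^ (p - 1) * (2 ^ (p - 1) * (C₁ * (X + Y + Z) +
          (1 - q)⁻¹ ^ p * C₂ * (X + Y + Z)) + C₃ * (X + Y + Z)) := by gcongr
    _ = _ := by ring

/-! ### The Aikawa condition and the Hardy inequality -/

theorem exists_mem_aikawaSet_lt (hn : n ≠ 0) {E : Set (EuclideanSpace ℝ (Fin n))} {a : ℝ}
    (h : aikawaDim E < a) : ∃ t ∈ aikawaSet E, t < a := by
  -- The infimum is not a junk value: the exponent `n` always belongs to the set.
  have hne : (aikawaSet E).Nonempty := by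
    refine ⟨n, by positivity, le_rfl,
      (volume (Metric.ball (0 : EuclideanSpace ℝ (Fin n)) 1)).toReal,
      ENNReal.toReal_pos (Metric.measure_ball_pos _ _ one_pos).ne' measure_ball_lt_top.ne, ?_⟩
    intro x _ r hr
    have h1 := volume_ball_mul hr x 1
    rw [mul_one] at h1
    simp only [sub_self, ENNReal.rpow_zero, lintegral_const, Measure.restrict_apply_univ, one_mul]
    rw [h1, ENNReal.ofReal_mul ENNReal.toReal_nonneg,
      ENNReal.ofReal_toReal measure_ball_lt_top.ne, mul_comm, Real.rpow_natCast,
      ENNReal.rpow_natCast, ENNReal.ofReal_pow hr.le]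
  exact exists_lt_of_csInf_lt hne h

theorem measurable_infEDist_frontier_rpow (a : ℝ) :
    Measurable fun x : EuclideanSpace ℝ (Fin n) => Metric.infEDist x (frontier G) ^ a :=
  measurable_infEDist.pow_const a

/-- The Aikawa condition, which concerns balls centred on the boundary, transferred to a ball about
an interior point `y` with radius comparable to the distance of `y` to the boundary. -/
theorem lintegral_infEDist_near_le (hG : IsOpen G) (hne : (frontier G).Nonempty) {t A : ℝ}
    (ht : 0 < t) (hA0 : 0 ≤ A)
    (hA : ∀ x ∈ frontier G, ∀ r : ℝ, 0 < r →
      ∫⁻ y in Metric.ball x r, Metric.infEDist y (frontier G) ^ (t - n) ≤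
        ENNReal.ofReal (A * r ^ t))
    {κ : ℝ} (hκ : 0 ≤ κ) {y : EuclideanSpace ℝ (Fin n)} (hy : y ∈ G) :
    ∫⁻ x in {x | dist x y ≤ κ * Metric.infDist y (frontier G)},
        Metric.infEDist x (frontier G) ^ (t - n) ≤
      ENNReal.ofReal (A * (κ + 2) ^ t) * Metric.infEDist y (frontier G) ^ t := by
  have hd := infDist_frontier_pos hG hne hy
  rw [infEDist_frontier_eq_ofReal hne]
  set d := Metric.infDist y (frontier G) with hd'
  obtain ⟨z, hz, hyz⟩ := (Metric.infDist_lt_iff hne).1 (show d < 2 * d by linarith)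
  calc _ ≤ ∫⁻ x in Metric.ball z ((κ + 2) * d), Metric.infEDist x (frontier G) ^ (t - n) := by
        refine lintegral_mono_set fun x hx => ?_
        have h1 := dist_triangle x y z
        rw [mem_ofPred_eq] at hx
        rw [Metric.mem_ball]
        linarith
    _ ≤ ENNReal.ofReal (A * ((κ + 2) * d) ^ t) := hA z hz _ (by positivity)
    _ = _ := by
        rw [Real.mul_rpow (by positivity) hd.le, ← mul_assoc,
          ENNReal.ofReal_mul (by positivity), ENNReal.ofReal_rpow_of_nonneg hd.le ht.le]

/-- The Aikawa condition turns the weighted integral of the chain terms into the seminorm, by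
Tonelli's theorem. -/
theorem lintegral_mul_chainIntegral_le (hG : IsOpen G) (hne : (frontier G).Nonempty) {t A : ℝ}
    (ht : 0 < t) (hA0 : 0 ≤ A)
    (hA : ∀ x ∈ frontier G, ∀ r : ℝ, 0 < r →
      ∫⁻ y in Metric.ball x r, Metric.infEDist y (frontier G) ^ (t - n) ≤
        ENNReal.ofReal (A * r ^ t))
    {κ : ℝ} (hκ : 0 ≤ κ) (hf : Measurable f) :
    ∫⁻ x in G, Metric.infEDist x (frontier G) ^ (t - n) * chainIntegral s p t κ G f x ≤
      ENNReal.ofReal (A * (κ + 2) ^ t) * ∫⁻ y in G, gagliardoDensity s p G f y := by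
  set D : EuclideanSpace ℝ (Fin n) → ℝ≥0∞ := fun x => Metric.infEDist x (frontier G) with hD
  set h : EuclideanSpace ℝ (Fin n) → ℝ≥0∞ := fun y =>
    D y ^ (-t) * gagliardoDensity s p G f y with hh
  have hD0 : ∀ y ∈ G, D y ≠ 0 := fun y hy => by
    simp only [hD]
    rw [infEDist_frontier_eq_ofReal hne]
    simpa using infDist_frontier_pos hG hne hy
  have hDt : ∀ y, D y ≠ ∞ := fun y => Metric.infEDist_ne_top hne
  have hhm : Measurable h :=
    (measurable_infEDist_frontier_rpow _).mul (measurable_gagliardoDensity hf s p G)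
  set S : Set (EuclideanSpace ℝ (Fin n) × EuclideanSpace ℝ (Fin n)) :=
    {z | dist z.1 z.2 ≤ κ * Metric.infDist z.2 (frontier G)} with hS
  have hSm : MeasurableSet S :=
    measurableSet_le measurable_dist ((measurable_infDist.comp measurable_snd).const_mul κ)
  set k : EuclideanSpace ℝ (Fin n) → EuclideanSpace ℝ (Fin n) → ℝ≥0∞ := fun x y =>
    S.indicator (fun z => D z.1 ^ (t - n) * h z.2) (x, y) with hk
  have hkm : Measurable (Function.uncurry k) :=
    (((measurable_infEDist_frontier_rpow (t - n)).comp measurable_fst).mul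
      (hhm.comp measurable_snd)).indicator hSm
  have hSx : ∀ x, MeasurableSet {y | (x, y) ∈ S} := fun x => measurable_prodMk_left hSm
  have hSy : ∀ y, MeasurableSet {x | (x, y) ∈ S} := fun y => measurable_prodMk_right hSm
  calc ∫⁻ x in G, D x ^ (t - n) * chainIntegral s p t κ G f x
      = ∫⁻ x in G, ∫⁻ y in G, k x y := by
        refine setLIntegral_congr_fun hG.measurableSet fun x hx => ?_
        have e : ∀ y, k x y = {y | (x, y) ∈ S}.indicator (fun y => D x ^ (t - n) * h y) y :=
          fun y => rfl
        simp only [e]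
        rw [setLIntegral_indicator (hSx x), lintegral_const_mul _ hhm, inter_comm]
        rfl
    _ = ∫⁻ y in G, ∫⁻ x in G, k x y := lintegral_lintegral_swap hkm.aemeasurable
    _ ≤ ∫⁻ y in G, ENNReal.ofReal (A * (κ + 2) ^ t) * gagliardoDensity s p G f y := by
        refine setLIntegral_mono' hG.measurableSet fun y hy => ?_
        have e : ∀ x, k x y = {x | (x, y) ∈ S}.indicator (fun x => D x ^ (t - n) * h y) x :=
          fun x => rfl
        simp only [e]
        rw [setLIntegral_indicator (hSy y), lintegral_mul_const _
          (measurable_infEDist_frontier_rpow _)]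
        calc (∫⁻ x in {x | (x, y) ∈ S} ∩ G, D x ^ (t - n)) * h y
            ≤ (ENNReal.ofReal (A * (κ + 2) ^ t) * D y ^ t) * h y := by
              gcongr
              exact (lintegral_mono_set inter_subset_left).trans
                (lintegral_infEDist_near_le hG hne ht hA0 hA hκ hy)
          _ = ENNReal.ofReal (A * (κ + 2) ^ t) * ((D y ^ t * D y ^ (-t)) *
                gagliardoDensity s p G f y) := by simp only [hh]; ring
          _ = _ := by
              rw [← ENNReal.rpow_add _ _ (hD0 y hy) (hDt y)]; simp
    _ = _ := lintegral_const_mul' _ _ ENNReal.ofReal_ne_top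

/-- Fractional Hardy inequality, with the lower order term `‖f‖_p`, on bounded open sets with
interior corkscrews whose boundary has Aikawa dimension less than `n - s p`. -/
theorem exists_fractional_hardy (hs : 0 < s) (hp : 1 ≤ p) (hG : IsOpen G)
    (hbd : Bornology.IsBounded G) (hne : (frontier G).Nonempty)
    {t : ℝ} (ht : t ∈ aikawaSet (frontier G)) (htn : t < n - s * p)
    {δ β : ℝ} (hδ : 0 < δ) (hβ : 1 ≤ β) (hcork : HasCorkscrews G δ β) :
    ∃ C : ℝ≥0∞, C ≠ ∞ ∧ ∀ f : EuclideanSpace ℝ (Fin n) → 𝕜, Measurable f → IntegrableOn f G →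
      ∫⁻ x in G, ‖f x‖ₑ ^ p * Metric.infEDist x (frontier G) ^ (-(s * p)) ≤
        C * ((∫⁻ x in G, ‖f x‖ₑ ^ p) + ∫⁻ x in G, gagliardoDensity s p G f x) := by
  obtain ⟨ht0, -, A, hA0, hA⟩ := ht
  have hβ0 : 0 < β := by linarith
  have hsp : 0 < s * p := by positivity
  set ε := n - s * p - t with hε
  have hε0 : 0 < ε := by linarith
  obtain ⟨C, hC, hpt⟩ := exists_enorm_rpow_le (𝕜 := 𝕜) hs hp hG hne ht0 hε0
    (by rw [hε]; ring) hδ hβ hcork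
  obtain ⟨z, hz⟩ := hne
  have hne : (frontier G).Nonempty := ⟨z, hz⟩
  obtain ⟨R, hR0, hR⟩ := hbd.subset_ball_lt 0 z
  set Δ := ENNReal.ofReal δ with hΔ
  have hΔ0 : Δ ≠ 0 := by simpa [hΔ] using hδ
  have hΔt : Δ ≠ ∞ := ENNReal.ofReal_ne_top
  set K₁ := ENNReal.ofReal (A * (4 * β + 2) ^ t)
  set K₂ := ENNReal.ofReal (A * R ^ t)
  have hΔs : Δ ^ (-(s * p)) ≠ ∞ := ENNReal.rpow_ne_top_of_ne_zero hΔ0 hΔt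
  have hΔε : Δ ^ ε ≠ ∞ := ENNReal.rpow_ne_top_of_nonneg hε0.le hΔt
  refine ⟨Δ ^ (-(s * p)) + C * (1 + K₁ + Δ ^ ε * K₂), by finiteness, ?_⟩
  intro f hfm hf
  set D : EuclideanSpace ℝ (Fin n) → ℝ≥0∞ := fun x => Metric.infEDist x (frontier G) with hD
  set F := gagliardoDensity s p G f with hF
  set T := chainIntegral s p t (4 * β) G f with hT
  set N := ∫⁻ x in G, ‖f x‖ₑ ^ p with hN
  set I := ∫⁻ x in G, F x with hI
  have hDt : ∀ y, D y ≠ ∞ := fun y => Metric.infEDist_ne_top hne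
  have hDm : ∀ a : ℝ, Measurable fun x => D x ^ a := measurable_infEDist_frontier_rpow
  have hFm : Measurable F := measurable_gagliardoDensity hfm s p G
  -- Far from the boundary the weight is bounded; close to it the pointwise estimate applies.
  have hpoint : ∀ x ∈ G, ‖f x‖ₑ ^ p * D x ^ (-(s * p)) ≤
      Δ ^ (-(s * p)) * ‖f x‖ₑ ^ p +
        C * (F x + D x ^ (t - n) * T x + (Δ ^ ε * N) * D x ^ (t - n)) := by
    intro x hx
    have hd0 := infDist_frontier_pos hG hne hx
    have hDx : D x = ENNReal.ofReal (Metric.infDist x (frontier G)) :=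
      infEDist_frontier_eq_ofReal hne x
    have hD0 : D x ≠ 0 := by rw [hDx]; simpa using hd0
    rcases lt_or_ge (Metric.infDist x (frontier G)) δ with hlt | hge
    · refine le_trans ?_ le_add_self
      have e1 : D x ^ (s * p) * D x ^ (-(s * p)) = 1 := by
        rw [← ENNReal.rpow_add _ _ hD0 (hDt x)]; simp
      have e2 : D x ^ (-ε) * D x ^ (-(s * p)) = D x ^ (t - n) := by
        rw [← ENNReal.rpow_add _ _ hD0 (hDt x)]; congr 1; rw [hε]; ring
      have e3 : D x ^ (-(s * p)) = D x ^ ε * D x ^ (t - n) := by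
        rw [← ENNReal.rpow_add _ _ hD0 (hDt x)]; congr 1; rw [hε]; ring
      have h4 : D x ^ ε ≤ Δ ^ ε := by
        gcongr; rw [hDx]; exact ENNReal.ofReal_le_ofReal hlt.le
      calc ‖f x‖ₑ ^ p * D x ^ (-(s * p))
          ≤ C * (D x ^ (s * p) * F x + D x ^ (-ε) * T x + N) * D x ^ (-(s * p)) := by
            gcongr; exact hpt f hf x hx hlt
        _ = C * ((D x ^ (s * p) * D x ^ (-(s * p))) * F x +
              (D x ^ (-ε) * D x ^ (-(s * p))) * T x + N * D x ^ (-(s * p))) := by ring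
        _ = C * (F x + D x ^ (t - n) * T x + N * (D x ^ ε * D x ^ (t - n))) := by
            rw [e1, e2, ← e3, one_mul]
        _ ≤ C * (F x + D x ^ (t - n) * T x + N * (Δ ^ ε * D x ^ (t - n))) := by gcongr
        _ = _ := by ring
    · refine le_trans ?_ le_self_add
      rw [mul_comm]
      gcongr ?_ * _
      rw [ENNReal.rpow_neg, ENNReal.rpow_neg, ENNReal.inv_le_inv]
      gcongr
      rw [hDx]
      exact ENNReal.ofReal_le_ofReal hge
  have hK₂ : ∫⁻ x in G, D x ^ (t - n) ≤ K₂ :=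
    (lintegral_mono_set hR).trans (hA z hz R hR0)
  have hK₁ : ∫⁻ x in G, D x ^ (t - n) * T x ≤ K₁ * I :=
    lintegral_mul_chainIntegral_le hG hne ht0 hA0.le hA (by positivity) hfm
  have hfp : Measurable fun x => ‖f x‖ₑ ^ p := hfm.enorm.pow_const p
  calc ∫⁻ x in G, ‖f x‖ₑ ^ p * D x ^ (-(s * p))
      ≤ ∫⁻ x in G, (Δ ^ (-(s * p)) * ‖f x‖ₑ ^ p +
        C * (F x + D x ^ (t - n) * T x + (Δ ^ ε * N) * D x ^ (t - n))) :=
        setLIntegral_mono' hG.measurableSet hpoint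
    _ = Δ ^ (-(s * p)) * N + C * (I + (∫⁻ x in G, D x ^ (t - n) * T x) +
          (Δ ^ ε * N) * ∫⁻ x in G, D x ^ (t - n)) := by
        rw [lintegral_add_left (hfp.const_mul _), lintegral_const_mul _ hfp,
          lintegral_const_mul' _ _ hC, lintegral_add_right _ ((hDm _).const_mul _),
          lintegral_add_left hFm, lintegral_const_mul _ (hDm _)]
    _ ≤ Δ ^ (-(s * p)) * (N + I) + C * ((N + I) + K₁ * (N + I) + (Δ ^ ε * (N + I)) * K₂) := by
        have h1 : N ≤ N + I := le_self_add
        have h2 : I ≤ N + I := le_add_self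
        gcongr
        exact hK₁.trans (by gcongr)
    _ = _ := by ring

/-! ### The interaction with the complement and the zero extension -/

/-- Integral of `|x - y| ^ (-q)` over the outside of a ball, for `q > n`, by summation over dyadic
annuli. -/
theorem exists_lintegral_edist_rpow_le {q : ℝ} (hq : (n : ℝ) < q) :
    ∃ C : ℝ≥0∞, C ≠ ∞ ∧ ∀ (x : EuclideanSpace ℝ (Fin n)) (r : ℝ), 0 < r →
      ∫⁻ y in {y | r ≤ dist x y}, (edist x y ^ q)⁻¹ ≤ C * ENNReal.ofReal r ^ ((n : ℝ) - q) := by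
  have hq0 : 0 ≤ q := le_trans (Nat.cast_nonneg n) hq.le
  set w : ℝ≥0∞ := 2 ^ ((n : ℝ) - q) with hw
  have hw1 : w < 1 := ENNReal.rpow_lt_one_of_one_lt_of_neg (by norm_num) (by linarith)
  set V := volume (Metric.ball (0 : EuclideanSpace ℝ (Fin n)) 2) with hV
  have hVt : V ≠ ∞ := measure_ball_lt_top.ne
  have hwt : (1 - w)⁻¹ ≠ ∞ := ENNReal.inv_ne_top.2 (tsub_pos_of_lt hw1).ne'
  refine ⟨(1 - w)⁻¹ * V, by finiteness, ?_⟩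
  intro x r hr
  set P := ENNReal.ofReal r with hP
  have hP0 : P ≠ 0 := by simpa [hP] using hr
  have hPt : P ≠ ∞ := ENNReal.ofReal_ne_top
  have hρ : ∀ k : ℕ, 0 < 2 ^ k * r := fun k => by positivity
  have hcover : {y | r ≤ dist x y} ⊆
      ⋃ k : ℕ, {y | 2 ^ k * r ≤ dist x y ∧ dist x y < 2 ^ (k + 1) * r} := by
    intro y hy
    rw [mem_ofPred_eq] at hy
    obtain ⟨k, hk1, hk2⟩ := exists_nat_pow_near (x := dist x y / r) (y := (2 : ℝ))
      (by rwa [one_le_div hr]) (by norm_num)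
    rw [le_div_iff₀ hr] at hk1
    rw [div_lt_iff₀ hr] at hk2
    exact mem_iUnion.2 ⟨k, hk1, hk2⟩
  have hann : ∀ k : ℕ,
      ∫⁻ y in {y | 2 ^ k * r ≤ dist x y ∧ dist x y < 2 ^ (k + 1) * r}, (edist x y ^ q)⁻¹ ≤
        w ^ k * (V * P ^ ((n : ℝ) - q)) := by
    intro k
    have hm : MeasurableSet {y | 2 ^ k * r ≤ dist x y ∧ dist x y < 2 ^ (k + 1) * r} :=
      (measurableSet_le measurable_const (measurable_const.dist measurable_id)).inter
        (measurableSet_lt (measurable_const.dist measurable_id) measurable_const)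
    have hQ0 : ENNReal.ofReal (2 ^ k * r) ≠ 0 := by
      rw [Ne, ENNReal.ofReal_eq_zero, not_le]; exact hρ k
    have e2 : ENNReal.ofReal (2 ^ k * r) = 2 ^ (k : ℝ) * P := by
      rw [ENNReal.ofReal_mul (by positivity), ENNReal.ofReal_pow (by norm_num),
        ENNReal.rpow_natCast]
      norm_num [hP]
    calc ∫⁻ y in {y | 2 ^ k * r ≤ dist x y ∧ dist x y < 2 ^ (k + 1) * r}, (edist x y ^ q)⁻¹
        ≤ ∫⁻ y in {y | 2 ^ k * r ≤ dist x y ∧ dist x y < 2 ^ (k + 1) * r},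
            (ENNReal.ofReal (2 ^ k * r) ^ q)⁻¹ := by
          refine setLIntegral_mono' hm fun y hy => ?_
          rw [ENNReal.inv_le_inv, edist_dist]
          gcongr
          exact hy.1
      _ = (ENNReal.ofReal (2 ^ k * r) ^ q)⁻¹ *
            volume {y | 2 ^ k * r ≤ dist x y ∧ dist x y < 2 ^ (k + 1) * r} := by
          rw [lintegral_const, Measure.restrict_apply_univ]
      _ ≤ (ENNReal.ofReal (2 ^ k * r) ^ q)⁻¹ * volume (Metric.ball x (2 ^ k * r * 2)) := by
          gcongr
          intro y hy
          rw [Metric.mem_ball, dist_comm]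
          have := hy.2
          rw [pow_succ] at this
          linarith
      _ = ENNReal.ofReal (2 ^ k * r) ^ ((n : ℝ) - q) * V := by
          rw [volume_ball_mul (hρ k), ← ENNReal.rpow_neg, ← mul_assoc,
            ← ENNReal.rpow_add _ _ hQ0 ENNReal.ofReal_ne_top]
          congr 2; ring
      _ = w ^ k * (V * P ^ ((n : ℝ) - q)) := by
          rw [e2, ENNReal.mul_rpow_of_ne_zero (by simp) hP0, ← ENNReal.rpow_mul, hw,
            ← ENNReal.rpow_natCast, ← ENNReal.rpow_mul, mul_comm (k : ℝ)]
          ring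
  calc _ ≤ ∫⁻ y in ⋃ k : ℕ, {y | 2 ^ k * r ≤ dist x y ∧ dist x y < 2 ^ (k + 1) * r},
          (edist x y ^ q)⁻¹ := lintegral_mono_set hcover
    _ ≤ ∑' k : ℕ, w ^ k * (V * P ^ ((n : ℝ) - q)) :=
        (lintegral_iUnion_le _ _).trans (ENNReal.tsum_le_tsum hann)
    _ = _ := by rw [ENNReal.tsum_mul_right, ENNReal.tsum_geometric]; ring

/-- Each `x ∈ G` is at distance at least `dist (x, ∂G)` from the complement of `G`. -/
theorem exists_lintegral_compl_le (hs : 0 < s) (hp : 1 ≤ p) (hG : IsOpen G)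
    (hne : (frontier G).Nonempty) :
    ∃ C : ℝ≥0∞, C ≠ ∞ ∧ ∀ x ∈ G,
      ∫⁻ y in Gᶜ, (edist x y ^ ((n : ℝ) + s * p))⁻¹ ≤
        C * Metric.infEDist x (frontier G) ^ (-(s * p)) := by
  have hsp : 0 < s * p := by positivity
  obtain ⟨C, hC, h⟩ := exists_lintegral_edist_rpow_le (n := n) (q := n + s * p) (by linarith)
  refine ⟨C, hC, fun x hx => ?_⟩
  have h1 := h x _ (infDist_frontier_pos hG hne hx)
  rw [infEDist_frontier_eq_ofReal hne]
  rw [show (n : ℝ) - (n + s * p) = -(s * p) by ring] at h1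
  exact (lintegral_mono_set fun y hy => infDist_frontier_le_dist hx hy).trans h1

/-- Splitting of the Gagliardo integral of the zero extension over `G` and its complement. -/
theorem lintegral_gagliardoDensity_zeroExtension (hp : 0 < p) (hG : MeasurableSet G)
    (hf : Measurable f) :
    ∫⁻ x, gagliardoDensity s p univ (zeroExtension G f) x =
      (∫⁻ x in G, gagliardoDensity s p G f x) +
        2 * ∫⁻ x in G, ‖f x‖ₑ ^ p * ∫⁻ y in Gᶜ, (edist x y ^ ((n : ℝ) + s * p))⁻¹ := by
  set g := zeroExtension G f with hg
  have hgm : Measurable g := hf.indicator hG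
  have hgG : ∀ x ∈ G, g x = f x := fun x hx => indicator_of_mem hx f
  have hgc : ∀ x ∈ Gᶜ, g x = 0 := fun x hx => indicator_of_notMem hx f
  set k : EuclideanSpace ℝ (Fin n) → EuclideanSpace ℝ (Fin n) → ℝ≥0∞ := fun x y =>
    ‖g x - g y‖ₑ ^ p / edist x y ^ ((n : ℝ) + s * p) with hk
  have hkm : Measurable (Function.uncurry k) := measurable_gagliardo_integrand hgm s p
  have hksymm : ∀ x y, k x y = k y x := fun x y => by
    simp only [hk]; rw [edist_comm, ← enorm_neg, neg_sub]
  have hmeas : ∀ A : Set (EuclideanSpace ℝ (Fin n)), Measurable fun x => ∫⁻ y in A, k x y :=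
    fun A => hkm.lintegral_prod_right'
  have hsplit : ∀ x, gagliardoDensity s p univ g x = (∫⁻ y in G, k x y) + ∫⁻ y in Gᶜ, k x y := by
    intro x
    rw [lintegral_add_compl _ hG, gagliardoDensity, setLIntegral_univ]
  have hGG : ∫⁻ x in G, ∫⁻ y in G, k x y = ∫⁻ x in G, gagliardoDensity s p G f x := by
    refine setLIntegral_congr_fun hG fun x hx => ?_
    refine setLIntegral_congr_fun hG fun y hy => ?_
    simp only [hk, hgG x hx, hgG y hy]
  have hGc : ∫⁻ x in G, ∫⁻ y in Gᶜ, k x y =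
      ∫⁻ x in G, ‖f x‖ₑ ^ p * ∫⁻ y in Gᶜ, (edist x y ^ ((n : ℝ) + s * p))⁻¹ := by
    refine setLIntegral_congr_fun hG fun x hx => ?_
    rw [← lintegral_const_mul' _ _ (ENNReal.rpow_ne_top_of_nonneg hp.le enorm_ne_top)]
    refine setLIntegral_congr_fun hG.compl fun y hy => ?_
    simp only [hk, hgG x hx, hgc y hy, sub_zero, div_eq_mul_inv]
  have hcG : ∫⁻ x in Gᶜ, ∫⁻ y in G, k x y = ∫⁻ x in G, ∫⁻ y in Gᶜ, k x y := by
    rw [lintegral_lintegral_swap hkm.aemeasurable]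
    simp only [hksymm]
  have hcc : ∫⁻ x in Gᶜ, ∫⁻ y in Gᶜ, k x y = 0 := by
    rw [setLIntegral_congr_fun (g := fun _ => 0) hG.compl, lintegral_zero]
    intro x hx
    simp only
    rw [setLIntegral_congr_fun (g := fun _ => 0) hG.compl, lintegral_zero]
    intro y hy
    simp [hk, hgc x hx, hgc y hy, hp]
  rw [← lintegral_add_compl _ hG]
  simp only [hsplit]
  rw [lintegral_add_left (hmeas G), lintegral_add_left (hmeas G), hcc, hcG, hGG, hGc, add_zero,
    two_mul, add_assoc]

theorem fracNorm_congr_ae {g : EuclideanSpace ℝ (Fin n) → 𝕜} (h : f =ᵐ[volume.restrict G] g) :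
    fracNorm s p G f = fracNorm s p G g := by
  have h1 : ∫⁻ x in G, ∫⁻ y in G, ‖f x - f y‖ₑ ^ p / edist x y ^ ((n : ℝ) + s * p) =
      ∫⁻ x in G, ∫⁻ y in G, ‖g x - g y‖ₑ ^ p / edist x y ^ ((n : ℝ) + s * p) := by
    refine lintegral_congr_ae ?_
    filter_upwards [h] with x hx
    refine lintegral_congr_ae ?_
    filter_upwards [h] with y hy
    rw [hx, hy]
  rw [fracNorm, fracNorm, eLpNorm_congr_ae h, fracSeminorm, fracSeminorm, h1]

/-- The norm bound for the zero extension under the hypotheses of the Hardy inequality. -/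
theorem exists_fracNorm_zeroExtension_le_of_measurable (hs : 0 < s) (hp : 1 ≤ p) (hG : IsOpen G)
    (hbd : Bornology.IsBounded G) (hne : (frontier G).Nonempty)
    {t : ℝ} (ht : t ∈ aikawaSet (frontier G)) (htn : t < n - s * p)
    {δ β : ℝ} (hδ : 0 < δ) (hβ : 1 ≤ β) (hcork : HasCorkscrews G δ β) :
    ∃ C : ℝ≥0, ∀ f : EuclideanSpace ℝ (Fin n) → 𝕜, Measurable f → IntegrableOn f G →
      fracNorm s p univ (zeroExtension G f) ≤ C * fracNorm s p G f := by
  have hp0 : 0 < p := by linarith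
  obtain ⟨C₁, hC₁, hhardy⟩ := exists_fractional_hardy (𝕜 := 𝕜) hs hp hG hbd hne ht htn hδ hβ hcork
  obtain ⟨C₂, hC₂, htail⟩ := exists_lintegral_compl_le hs hp hG hne
  set K : ℝ≥0∞ := 1 + 2 * (C₂ * C₁) with hK
  have hKt : K ^ (1 / p) ≠ ∞ := ENNReal.rpow_ne_top_of_nonneg (by positivity) (by finiteness)
  refine ⟨(1 + K ^ (1 / p)).toNNReal, fun f hfm hf => ?_⟩
  rw [ENNReal.coe_toNNReal (by finiteness)]
  set N := ∫⁻ x in G, ‖f x‖ₑ ^ p with hN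
  set I := ∫⁻ x in G, gagliardoDensity s p G f x with hI
  have hLp : eLpNorm f (ENNReal.ofReal p) (volume.restrict G) = N ^ (1 / p) := by
    rw [eLpNorm_eq_lintegral_rpow_enorm_toReal (by simpa using hp0) ENNReal.ofReal_ne_top,
      ENNReal.toReal_ofReal hp0.le]
  have hnorm : fracNorm s p G f = N ^ (1 / p) + I ^ (1 / p) := by
    rw [fracNorm, hLp]; rfl
  have hLpE : eLpNorm (zeroExtension G f) (ENNReal.ofReal p) (volume.restrict univ) =
      N ^ (1 / p) := by
    rw [Measure.restrict_univ, zeroExtension,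
      eLpNorm_indicator_eq_eLpNorm_restrict hG.measurableSet, hLp]
  have hnormE : fracNorm s p univ (zeroExtension G f) = N ^ (1 / p) +
      (∫⁻ x, gagliardoDensity s p univ (zeroExtension G f) x) ^ (1 / p) := by
    rw [fracNorm, hLpE, fracSeminorm, setLIntegral_univ]; rfl
  have hIE : ∫⁻ x, gagliardoDensity s p univ (zeroExtension G f) x ≤ K * (N + I) := by
    rw [lintegral_gagliardoDensity_zeroExtension hp0 hG.measurableSet hfm]
    calc I + 2 * ∫⁻ x in G, ‖f x‖ₑ ^ p * ∫⁻ y in Gᶜ, (edist x y ^ ((n : ℝ) + s * p))⁻¹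
        ≤ I + 2 * ∫⁻ x in G, C₂ * (‖f x‖ₑ ^ p * Metric.infEDist x (frontier G) ^ (-(s * p))) := by
          gcongr I + 2 * ?_
          refine setLIntegral_mono' hG.measurableSet fun x hx => ?_
          rw [mul_left_comm]
          gcongr
          exact htail x hx
      _ ≤ (N + I) + 2 * (C₂ * (C₁ * (N + I))) := by
          rw [lintegral_const_mul' _ _ hC₂]
          gcongr
          · exact le_add_self
          · exact hhardy f hfm hf
      _ = K * (N + I) := by rw [hK]; ring
  rw [hnorm, hnormE]
  calc N ^ (1 / p) + (∫⁻ x, gagliardoDensity s p univ (zeroExtension G f) x) ^ (1 / p)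
      ≤ (N ^ (1 / p) + I ^ (1 / p)) + K ^ (1 / p) * (N ^ (1 / p) + I ^ (1 / p)) := by
        refine add_le_add le_self_add ?_
        calc _ ≤ (K * (N + I)) ^ (1 / p) := by gcongr
          _ = K ^ (1 / p) * (N + I) ^ (1 / p) := ENNReal.mul_rpow_of_nonneg _ _ (by positivity)
          _ ≤ _ := by
            gcongr
            exact ENNReal.rpow_add_le_add_rpow _ _ (by positivity)
              ((div_le_one hp0).2 hp)
    _ = _ := by ring

end FracSob

theorem mainTheorem4 {𝕜 : Type*} [RCLike 𝕜] (n : ℕ) (hn : 2 ≤ n) (p s : ℝ) (hp : 1 < p)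
    (hs : 0 < s) (hs' : s < min 1 ((n : ℝ) / p))
    (G : Set (EuclideanSpace ℝ (Fin n))) (hG : FracSob.IsJohnDomain G)
    (hdim : FracSob.aikawaDim (frontier G) < (n : ℝ) - s * p) :
    ∃ C : ℝ≥0, ∀ f : EuclideanSpace ℝ (Fin n) → 𝕜, FracSob.MemFracSobolev s p G f →
      FracSob.MemFracSobolev s p univ (FracSob.zeroExtension G f) ∧
      FracSob.fracNorm s p univ (FracSob.zeroExtension G f) ≤ C * FracSob.fracNorm s p G f := by
  have hopen : IsOpen G := hG.1
  have hbd : Bornology.IsBounded G := hG.2.2.1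
  have hne : (frontier G).Nonempty := by
    rw [nonempty_iff_ne_empty, Ne, frontier_eq_empty_iff, not_or]
    have : Nonempty (Fin n) := ⟨⟨0, by omega⟩⟩
    refine ⟨hG.2.1.nonempty.ne_empty, ?_⟩
    rintro rfl
    exact NormedSpace.unbounded_univ ℝ (EuclideanSpace ℝ (Fin n)) hbd
  obtain ⟨t, ht, htn⟩ := FracSob.exists_mem_aikawaSet_lt (by omega) hdim
  obtain ⟨δ, β, hδ, hβ, hcork⟩ := hG.hasCorkscrews hne
  obtain ⟨C, hC⟩ := FracSob.exists_fracNorm_zeroExtension_le_of_measurable (𝕜 := 𝕜) hs hp.le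
    hopen hbd hne ht htn hδ hβ hcork
  refine ⟨C, fun f hf => ?_⟩
  -- Both norms depend only on the class of `f` modulo null sets, so `f` may be replaced by a
  -- measurable representative.
  obtain ⟨g, hg, hfg⟩ := hf.1.aestronglyMeasurable
  have hext : FracSob.zeroExtension G f =ᵐ[volume.restrict univ] FracSob.zeroExtension G g := by
    rw [Measure.restrict_univ]
    exact (ae_eq_restrict_iff_indicator_ae_eq hopen.measurableSet).1 hfg
  have : IsFiniteMeasure (volume.restrict G) := ⟨by
    simpa using hbd.measure_lt_top⟩
  have hfint : IntegrableOn f G := hf.1.integrable (by simpa using hp.le)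
  have hle : FracSob.fracNorm s p univ (FracSob.zeroExtension G f) ≤
      C * FracSob.fracNorm s p G f := by
    rw [FracSob.fracNorm_congr_ae hfg, FracSob.fracNorm_congr_ae hext]
    exact hC g hg.measurable (hfint.congr hfg)
  have hlp : MemLp (FracSob.zeroExtension G f) (ENNReal.ofReal p) (volume.restrict univ) := by
    rw [Measure.restrict_univ]
    exact (memLp_indicator_iff_restrict hopen.measurableSet).2 hf.1
  exact ⟨⟨hlp, hle.trans_lt (ENNReal.mul_lt_top ENNReal.coe_lt_top hf.2)⟩, hle⟩
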